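/- Let $\alpha\in(0,\tfrac12)$ and let $X$ be a real random variable with distribution function $F(t)=\mathbb P(X\le t)$. For a distribution function $G$ put $\mathrm{VaR}_u(G)=\inf\{t\in\mathbb R: G(t)\ge u\}$ and $\mathrm{ES}_\alpha(G)=\frac1\alpha\int_{1-\alpha}^1\mathrm{VaR}_u(G)\,du$; write $\mathrm{VaR}_u(X)=\mathrm{VaR}_u(F)$, $\mathrm{ES}_\alpha(X)=\mathrm{ES}_\alpha(F)$, and let $$\sigma_{\mathrm{ES}}^2=\frac1{\alpha^2}\int_{\mathrm{VaR}_{1-\alpha}(X)}^\infty\int_{\mathrm{VaR}_{1-\alpha}(X)}^\infty \bigl(F(\min\{t,s\})-F(t)F(s)\bigr)\,dt\,ds\in[0,\infty].$$ Let $X_1,\dots,X_N$ be i.i.d. copies of $X$. For a nonempty $I\subseteq\{1,\dots,N\}$ let $\widehat F_I(t)=\frac1{|I|}\sum_{i\in I}\mathbf 1_{\{X_i\le t\}}$ and $\widehat T_I=\mathrm{ES}_\alpha(\widehat F_I)$, and let $\widehat T_N=\widehat T_{\{1,\dots,N\}}$. Given $\varepsilon>0$, set $m=\lceil 11/\varepsilon^2\rceil$,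 $n=\lfloor N/m\rfloor$ and $I_j=\{(j-1)m+1,\dots,jm\}$ for $j=1,\dots,n$. Let $\widehat T_{(1)}\le\dots\le\widehat T_{(n)}$ be the order statistics of $\widehat T_{I_1},\dots,\widehat T_{I_n}$, and let $\widehat Q:[0,1]\to\mathbb R$ be the piecewise linear function interpolating the values $\widehat Q\bigl(\tfrac{j-1}{n-1}\bigr)=\widehat T_{(j)}$, $j=1,\dots,n$ (a constant function if $n=1$). For $0.35\le\beta_1\le\beta_2\le0.65$ define $$\widehat S_N=\min\bigl\{\max\{\widehat T_N,\widehat Q(\beta_1)\},\widehat Q(\beta_2)\bigr\}.$$ **Theorem.** There are absolute constants $c_0,c_1,c_2,c_3>0$ such that the following holds for all $\alpha\in(0,\frac12)$, all $0.35\le\beta_1\le\beta_2\le0.65$ and all $X$. Assume that $\sigma^2_{\mathrm{ES}}<\infty$, that $u\mapsto\mathrm{VaR}_u(X)$ is $L$-Lipschitz on $[1-2\alpha,1-\frac12\alpha]$ for some $L\ge0$, and that $\sigma_{\mathrm{ES}}>0$ or $L>0$. Then for every $0<\varepsilon<c_0\sqrt\alpha$ and every integer $N\ge c_1\varepsilon^{-2}$,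 $$\mathbb P\Bigl(\bigl|\widehat S_N-\mathrm{ES}_\alpha(X)\bigr|\ge\varepsilon\,\sigma_{\mathrm{ES}}+c_2L\varepsilon^2\Bigr)\le\exp\bigl(-c_3N\varepsilon^2\bigr).$$ -/

import Mathlib

open MeasureTheory ProbabilityTheory Set
open scoped ENNReal NNReal

noncomputable section

namespace ExpectedShortfall

/-- Value at risk at level `u` of the distribution function `F`:
`VaR_u = inf {t ∈ ℝ : F(t) ≥ u}`. -/
def VaR (F : ℝ → ℝ) (u : ℝ) : ℝ :=
  sInf {t : ℝ | u ≤ F t}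

/-- Expected shortfall at level `α` of the distribution function `F`. -/
def ES (α : ℝ) (F : ℝ → ℝ) : ℝ :=
  (1 / α) * ∫ u in (1 - α)..1, VaR F u

/-- The variance `σ²_ES ∈ [0, ∞]` attached to the estimation of the expected shortfall. The
integrand is nonnegative whenever `F` is a distribution function, so that `ENNReal.ofReal` does
not change it. -/
def sigmaSq (α : ℝ) (F : ℝ → ℝ) : ℝ≥0∞ :=
  ENNReal.ofReal (1 / α ^ 2) *
    ∫⁻ s in Ici (VaR F (1 - α)), ∫⁻ t in Ici (VaR F (1 - α)),
      ENNReal.ofReal (F (min t s) - F t * F s)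

/-- `σ_ES`, the square root of the variance (meaningful when the latter is finite). -/
def sigma (α : ℝ) (F : ℝ → ℝ) : ℝ :=
  Real.sqrt (sigmaSq α F).toReal

/-- The empirical distribution function of the subsample `(x i)_{i ∈ I}`. -/
def empiricalCDF {N : ℕ} (x : Fin N → ℝ) (I : Finset (Fin N)) (t : ℝ) : ℝ :=
  (1 / (I.card : ℝ)) * ∑ i ∈ I, (Iic t).indicator (fun _ => (1 : ℝ)) (x i)

/-- The plug-in estimator of the expected shortfall based on the subsample `(x i)_{i ∈ I}`. -/
def plugIn {N : ℕ} (α : ℝ) (x : Fin N → ℝ) (I : Finset (Fin N)) : ℝ :=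
  ES α (empiricalCDF x I)

/-- The `j`-th block of `m` consecutive indices; samples and blocks are numbered from `0`. -/
def block (N m j : ℕ) : Finset (Fin N) :=
  Finset.univ.filter fun i => j * m ≤ (i : ℕ) ∧ (i : ℕ) < (j + 1) * m

/-- The order statistics `T_(0) ≤ T_(1) ≤ … ≤ T_(n-1)` of the vector `T`, numbered from `0`
(with the value `0` outside that range). -/
def orderStat {n : ℕ} (T : Fin n → ℝ) (k : ℕ) : ℝ :=
  if h : k < n then T (Tuple.sort T ⟨k, h⟩) else 0

/-- The linearly interpolated empirical quantile function of the vector `T`: for `β ∈ [0, 1]` it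
is the piecewise linear interpolation of the values `T_(k)` at the nodes `k / (n - 1)`,
`k = 0, …, n - 1`. -/
def interpQuantile {n : ℕ} (T : Fin n → ℝ) (β : ℝ) : ℝ :=
  let h : ℝ := ((n : ℝ) - 1) * β
  let k : ℕ := ⌊h⌋₊
  orderStat T k + (h - k) * (orderStat T (k + 1) - orderStat T k)

/-- The block size `m = ⌈11 / ε²⌉`. -/
def blockSize (ε : ℝ) : ℕ := ⌈11 / ε ^ 2⌉₊

/-- The number of blocks `n = ⌊N / m⌋` (division of natural numbers). -/
def numBlocks (N : ℕ) (ε : ℝ) : ℕ := N / blockSize ε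

/-- The vector of the blockwise plug-in estimators. -/
def blockEstimates {N : ℕ} (α ε : ℝ) (x : Fin N → ℝ) : Fin (numBlocks N ε) → ℝ :=
  fun j => plugIn α x (block N (blockSize ε) j)

/-- The estimator `S_N`: the plug-in estimator on the whole sample, truncated to the interval
between the `β₁`- and the `β₂`-quantile of the blockwise plug-in estimators. -/
def estimator {N : ℕ} (α ε β₁ β₂ : ℝ) (x : Fin N → ℝ) : ℝ :=
  min (max (plugIn α x Finset.univ) (interpQuantile (blockEstimates α ε x) β₁))
    (interpQuantile (blockEstimates α ε x) β₂)

end ExpectedShortfall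

end

/-! By Rockafellar–Uryasev, the expected shortfall is the minimum over t of t + E(X - t)₊/α,
attained at q = VaR_{1-α}. Applied to an empirical measure, this makes each block estimate the
minimum of a convex function `empPhi`. Its value at q bounds the estimate from above
(`plugIn_le_empPhi`). It also nearly bounds it from below: if the empirical tail frequencies at q
and at the quantiles of levels 1 - (α ± δ) are within δ of their targets, the one-sided slopes at q
are at worst -δ/α towards either side. The minimum then lies within Lδ · δ/α of the value at q
(`empPhi_sub_le`).

The value at q is an average of i.i.d. excesses, whose standard deviation is ασ_ES by Hoeffding's
covariance formula (`variance_excess`). With δ of order ε√α, Chebyshev makes a block of size about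
11/ε² good with probability at least 0.88 (`measure_not_isGoodSample_le`).

Blocks are independent, so Hoeffding's inequality leaves fewer than a quarter of them bad up to
probability exp(-0.03n) (`measure_quarter_le`). Both truncation quantiles then lie in the target
interval, and so does the truncated estimator, wherever the full-sample estimate is. -/

namespace ExpectedShortfall

/-! ### Quantile functions and the Rockafellar–Uryasev formula -/

section Quantile

/-- The Galois connection between the quantile function and the distribution function. -/
lemma VaR_le_iff (μ : Measure ℝ) {u : ℝ} (hu0 : 0 < u) (hu1 : u < 1) (t : ℝ) :
    VaR (cdf μ) u ≤ t ↔ u ≤ cdf μ t := by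
  have hne : {t : ℝ | u ≤ cdf μ t}.Nonempty :=
    ((tendsto_cdf_atTop μ).eventually_const_le hu1).exists
  have hbdd : BddBelow {t : ℝ | u ≤ cdf μ t} := by
    obtain ⟨b, hb⟩ := ((tendsto_cdf_atBot μ).eventually_lt_const hu0).exists
    refine ⟨b, fun t ht => ?_⟩
    by_contra! h
    exact absurd (ht.trans (monotone_cdf μ h.le)) (not_le.2 hb)
  refine ⟨fun h => ?_, fun h => csInf_le hbdd h⟩
  have hmem : ∀ s, t < s → u ≤ cdf μ s := by
    intro s hs
    obtain ⟨r, hr, hrs⟩ := exists_lt_of_csInf_lt hne (lt_of_le_of_lt h hs)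
    exact le_trans hr (monotone_cdf μ hrs.le)
  have hc : Filter.Tendsto (cdf μ) (nhdsWithin t (Ioi t)) (nhds (cdf μ t)) :=
    ((cdf μ).right_continuous t).mono_left (nhdsWithin_mono _ Ioi_subset_Ici_self)
  exact ge_of_tendsto hc (Filter.eventually_of_mem self_mem_nhdsWithin hmem)

lemma VaR_monotoneOn (μ : Measure ℝ) : MonotoneOn (VaR (cdf μ)) (Ioo 0 1) := fun _ hu _ hv huv =>
  (VaR_le_iff μ hu.1 hu.2 _).2 (huv.trans ((VaR_le_iff μ hv.1 hv.2 _).1 le_rfl))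

lemma aemeasurable_VaR (μ : Measure ℝ) : AEMeasurable (VaR (cdf μ)) (volume.restrict (Ioo 0 1)) :=
  aemeasurable_restrict_of_monotoneOn measurableSet_Ioo (VaR_monotoneOn μ)

variable (μ : Measure ℝ) [IsProbabilityMeasure μ]

/-- The quantile function transports the uniform distribution to `μ`. -/
lemma map_VaR : (volume.restrict (Ioo (0 : ℝ) 1)).map (VaR (cdf μ)) = μ := by
  have : IsProbabilityMeasure (volume.restrict (Ioo (0 : ℝ) 1)) := ⟨by simp⟩
  have : IsProbabilityMeasure ((volume.restrict (Ioo (0 : ℝ) 1)).map (VaR (cdf μ))) :=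
    Measure.isProbabilityMeasure_map (aemeasurable_VaR μ)
  refine Measure.ext_of_Iic _ _ fun t => ?_
  rw [Measure.map_apply_of_aemeasurable (aemeasurable_VaR μ) measurableSet_Iic,
    Measure.restrict_apply' measurableSet_Ioo, ← ofReal_cdf μ t]
  have h : VaR (cdf μ) ⁻¹' Iic t ∩ Ioo 0 1 = Iic (cdf μ t) ∩ Ioo 0 1 := by
    ext u
    simp only [mem_inter_iff, mem_preimage, mem_Iic, and_congr_left_iff]
    exact fun hu => VaR_le_iff μ hu.1 hu.2 t
  rw [h]
  refine le_antisymm ?_ ?_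
  · calc volume (Iic (cdf μ t) ∩ Ioo 0 1) ≤ volume (Ioc 0 (cdf μ t)) :=
        measure_mono fun u (hu : u ∈ Iic (cdf μ t) ∩ Ioo 0 1) => mem_Ioc.2 ⟨hu.2.1, hu.1⟩
      _ = _ := by simp
  · calc ENNReal.ofReal (cdf μ t) = volume (Ioo 0 (cdf μ t)) := by simp
      _ ≤ volume (Iic (cdf μ t) ∩ Ioo 0 1) :=
        measure_mono fun u (hu : u ∈ Ioo 0 (cdf μ t)) =>
          ⟨hu.2.le, hu.1, hu.2.trans_le (cdf_le_one μ t)⟩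

lemma measure_Ioi_VaR_le {u : ℝ} (hu : u ∈ Ioo (0 : ℝ) 1) :
    μ.real (Ioi (VaR (cdf μ) u)) ≤ 1 - u := by
  have h1 : u ≤ μ.real (Iic (VaR (cdf μ) u)) := by
    rw [← cdf_eq_real]
    exact (VaR_le_iff μ hu.1 hu.2 _).1 le_rfl
  rw [← compl_Iic, probReal_compl_eq_one_sub measurableSet_Iic]
  linarith

/-- By `map_VaR`, μ is the law of the quantile at a uniform level, and every level above u gives a
value in the closed tail. An atom at the quantile is why the upper bound uses the open tail and this
one the closed tail. -/
lemma le_measure_Ici_VaR {u : ℝ} (hu : u ∈ Ioo (0 : ℝ) 1) :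
    1 - u ≤ μ.real (Ici (VaR (cdf μ) u)) := by
  have h : μ (Ici (VaR (cdf μ) u)) =
      volume (VaR (cdf μ) ⁻¹' Ici (VaR (cdf μ) u) ∩ Ioo 0 1) := by
    conv_lhs => rw [← map_VaR μ]
    rw [Measure.map_apply_of_aemeasurable (aemeasurable_VaR μ) measurableSet_Ici,
      Measure.restrict_apply' measurableSet_Ioo]
    -- The first rewriting also replaced the μ inside the quantile; this restores it.
    rw [map_VaR μ]
  have h2 : ENNReal.ofReal (1 - u) ≤ μ (Ici (VaR (cdf μ) u)) := by
    rw [h, ← Real.volume_Ioo]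
    refine measure_mono fun v (hv : v ∈ Ioo _ _) => ?_
    have hv' : v ∈ Ioo (0 : ℝ) 1 := ⟨hu.1.trans hv.1, hv.2⟩
    exact ⟨VaR_monotoneOn μ hu hv' hv.1.le, hv'⟩
  exact (ENNReal.ofReal_le_iff_le_toReal (measure_ne_top _ _)).1 h2

variable {μ}

lemma integrableOn_excess_VaR {t : ℝ} (hint : Integrable (fun x => max (x - t) 0) μ) :
    IntegrableOn (fun u => max (VaR (cdf μ) u - t) 0) (Ioo 0 1) := by
  rw [← map_VaR μ] at hint
  exact hint.comp_aemeasurable (aemeasurable_VaR μ)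

lemma integral_excess_VaR (t : ℝ) :
    ∫ u in Ioo 0 1, max (VaR (cdf μ) u - t) 0 = ∫ x, max (x - t) 0 ∂μ := by
  have h := integral_map (aemeasurable_VaR μ) (f := fun x => max (x - t) 0)
    (Continuous.aestronglyMeasurable (by fun_prop))
  rw [map_VaR μ] at h
  exact h.symm

lemma integrableOn_VaR {α : ℝ} (hα : α ∈ Ioo (0 : ℝ) 1)
    (hint : Integrable (fun x => max (x - VaR (cdf μ) (1 - α)) 0) μ) :
    IntegrableOn (VaR (cdf μ)) (Ioo (1 - α) 1) := by
  have hsub : Ioo (1 - α) 1 ⊆ Ioo (0 : ℝ) 1 := Ioo_subset_Ioo_left (by linarith [hα.2])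
  have h := ((integrableOn_excess_VaR hint).mono_set hsub).add
    (integrableOn_const (C := VaR (cdf μ) (1 - α)) (by simp))
  refine h.congr_fun (fun u hu => ?_) measurableSet_Ioo
  have := VaR_monotoneOn μ ⟨by linarith [hα.2], by linarith [hα.1]⟩ (hsub hu) hu.1.le
  simp only [Pi.add_apply]
  rw [max_eq_left (by linarith)]
  ring

/-- Discards the level u = 1, where the infimum may be over an empty set and take a default value.
-/
lemma ES_eq_setIntegral {α : ℝ} (hα : 0 < α) (F : ℝ → ℝ) :
    ES α F = (1 / α) * ∫ u in Ioo (1 - α) 1, VaR F u := by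
  rw [ES, intervalIntegral.integral_of_le (by linarith), integral_Ioc_eq_integral_Ioo]

/-- The Rockafellar–Uryasev representation at the value at risk. -/
lemma ES_eq {α : ℝ} (hα : α ∈ Ioo (0 : ℝ) 1)
    (hint : Integrable (fun x => max (x - VaR (cdf μ) (1 - α)) 0) μ) :
    ES α (cdf μ) = VaR (cdf μ) (1 - α) +
      (1 / α) * ∫ x, max (x - VaR (cdf μ) (1 - α)) 0 ∂μ := by
  have hsub : Ioo (1 - α) 1 ⊆ Ioo (0 : ℝ) 1 := Ioo_subset_Ioo_left (by linarith [hα.2])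
  have hmem : 1 - α ∈ Ioo (0 : ℝ) 1 := ⟨by linarith [hα.2], by linarith [hα.1]⟩
  have h1 : ∫ u in Ioo (1 - α) 1, max (VaR (cdf μ) u - VaR (cdf μ) (1 - α)) 0 =
      ∫ u in Ioo 0 1, max (VaR (cdf μ) u - VaR (cdf μ) (1 - α)) 0 := by
    refine (setIntegral_eq_of_subset_of_forall_sdiff_eq_zero measurableSet_Ioo hsub ?_).symm
    rintro u ⟨hu, hu'⟩
    have : u ≤ 1 - α := by
      by_contra! h
      exact hu' ⟨h, hu.2⟩
    exact max_eq_right (by linarith [VaR_monotoneOn μ hu hmem this])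
  have h2 : ∫ u in Ioo (1 - α) 1, max (VaR (cdf μ) u - VaR (cdf μ) (1 - α)) 0 =
      ∫ u in Ioo (1 - α) 1, (VaR (cdf μ) u - VaR (cdf μ) (1 - α)) :=
    setIntegral_congr_fun measurableSet_Ioo fun u hu =>
      max_eq_left (by linarith [VaR_monotoneOn μ hmem (hsub hu) hu.1.le])
  rw [integral_sub (integrableOn_VaR hα hint) (integrableOn_const (by simp)), setIntegral_const,
    Real.volume_real_Ioo_of_le (by linarith [hα.1]), smul_eq_mul] at h2
  rw [ES_eq_setIntegral hα.1, ← integral_excess_VaR, ← h1, h2]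
  have := hα.1.ne'
  field_simp
  ring

/-- The expected shortfall is bounded by every value of the Rockafellar–Uryasev functional. -/
lemma ES_le {α : ℝ} (hα : α ∈ Ioo (0 : ℝ) 1)
    (hint : Integrable (fun x => max (x - VaR (cdf μ) (1 - α)) 0) μ) (t : ℝ)
    (hint' : Integrable (fun x => max (x - t) 0) μ) :
    ES α (cdf μ) ≤ t + (1 / α) * ∫ x, max (x - t) 0 ∂μ := by
  have hsub : Ioo (1 - α) 1 ⊆ Ioo (0 : ℝ) 1 := Ioo_subset_Ioo_left (by linarith [hα.2])
  have hI := integrableOn_excess_VaR hint'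
  have h1 : ∫ u in Ioo (1 - α) 1, VaR (cdf μ) u ≤
      ∫ u in Ioo (1 - α) 1, (t + max (VaR (cdf μ) u - t) 0) :=
    integral_mono (integrableOn_VaR hα hint)
      ((integrableOn_const (by simp)).add (hI.mono_set hsub))
      fun u => by linarith [le_max_left (VaR (cdf μ) u - t) 0]
  rw [integral_add (integrableOn_const (C := t) (by simp)).integrable (hI.mono_set hsub), setIntegral_const,
    Real.volume_real_Ioo_of_le (by linarith [hα.1]), smul_eq_mul] at h1
  have h2 : ∫ u in Ioo (1 - α) 1, max (VaR (cdf μ) u - t) 0 ≤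
      ∫ u in Ioo 0 1, max (VaR (cdf μ) u - t) 0 :=
    setIntegral_mono_set hI (ae_of_all _ fun _ => le_max_right _ _) hsub.eventuallyLE
  rw [integral_excess_VaR] at h2
  rw [ES_eq_setIntegral hα.1]
  calc 1 / α * ∫ u in Ioo (1 - α) 1, VaR (cdf μ) u
      ≤ 1 / α * (α * t + ∫ x, max (x - t) 0 ∂μ) :=
        mul_le_mul_of_nonneg_left (by linarith) (by have := hα.1; positivity)
    _ = _ := by
        have := hα.1.ne'
        field_simp

end Quantile

/-! ### Empirical measures and the convex functional of a sample -/

section Empirical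

variable {N : ℕ}

/-- The average of `f` over the subsample `(x i)_{i ∈ I}`. -/
noncomputable def empMean (x : Fin N → ℝ) (I : Finset (Fin N)) (f : ℝ → ℝ) : ℝ :=
  (1 / (I.card : ℝ)) * ∑ i ∈ I, f (x i)

/-- The relative frequency of the set `A` in the subsample `(x i)_{i ∈ I}`. -/
noncomputable def empFreq (x : Fin N → ℝ) (I : Finset (Fin N)) (A : Set ℝ) : ℝ :=
  empMean x I (A.indicator fun _ => 1)

/-- The empirical measure of the subsample `(x i)_{i ∈ I}`. -/
noncomputable def empMeasure (x : Fin N → ℝ) (I : Finset (Fin N)) : Measure ℝ :=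
  (I.card : ℝ≥0∞)⁻¹ • ∑ i ∈ I, Measure.dirac (x i)

variable {x : Fin N → ℝ} {I : Finset (Fin N)}

lemma isProbabilityMeasure_empMeasure (hI : I.Nonempty) :
    IsProbabilityMeasure (empMeasure x I) := by
  refine ⟨?_⟩
  simp only [empMeasure, Measure.smul_apply, Measure.finsetSum_apply, measure_univ,
    Finset.sum_const, smul_eq_mul, nsmul_eq_mul, mul_one]
  exact ENNReal.inv_mul_cancel (by simpa using hI.ne_empty) (by simp)

lemma integrable_empMeasure (hI : I.Nonempty) (f : ℝ → ℝ) : Integrable f (empMeasure x I) := by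
  refine Integrable.smul_measure ?_ (by simpa using hI.ne_empty)
  exact integrable_finsetSum_measure.2 fun i _ => integrable_dirac (by simp)

lemma integral_empMeasure (f : ℝ → ℝ) : ∫ y, f y ∂(empMeasure x I) = empMean x I f := by
  rw [empMeasure, integral_smul_measure,
    integral_finsetSum_measure fun i _ => integrable_dirac (by simp)]
  simp [empMean]

/-- Makes the formulas for probability measures available for the plug-in estimator. -/
lemma cdf_empMeasure (hI : I.Nonempty) : ⇑(cdf (empMeasure x I)) = empiricalCDF x I := by
  have := isProbabilityMeasure_empMeasure (x := x) hI
  funext t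
  rw [cdf_eq_real, ← integral_indicator_one measurableSet_Iic, integral_empMeasure]
  rfl

/-- The Rockafellar–Uryasev functional of the subsample `(x i)_{i ∈ I}`. -/
noncomputable def empPhi (α : ℝ) (x : Fin N → ℝ) (I : Finset (Fin N)) (t : ℝ) : ℝ :=
  t + (1 / α) * empMean x I fun y => max (y - t) 0

/-- The witness is the empirical value at risk. Together with `plugIn_le_empPhi`, this says that the
estimator is the minimum of `empPhi`. -/
lemma exists_plugIn_eq_empPhi {α : ℝ} (hα : α ∈ Ioo (0 : ℝ) 1) (hI : I.Nonempty) :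
    ∃ t, plugIn α x I = empPhi α x I t := by
  have := isProbabilityMeasure_empMeasure (x := x) hI
  refine ⟨VaR (cdf (empMeasure x I)) (1 - α), ?_⟩
  rw [plugIn, ← cdf_empMeasure hI, ES_eq hα (integrable_empMeasure hI _), integral_empMeasure]
  rfl

lemma plugIn_le_empPhi {α : ℝ} (hα : α ∈ Ioo (0 : ℝ) 1) (hI : I.Nonempty) (t : ℝ) :
    plugIn α x I ≤ empPhi α x I t := by
  have := isProbabilityMeasure_empMeasure (x := x) hI
  rw [plugIn, ← cdf_empMeasure hI]
  refine (ES_le hα (integrable_empMeasure hI _) t (integrable_empMeasure hI _)).trans ?_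
  rw [integral_empMeasure]
  rfl

lemma empMean_mono {f g : ℝ → ℝ} (h : ∀ y, f y ≤ g y) : empMean x I f ≤ empMean x I g :=
  mul_le_mul_of_nonneg_left (Finset.sum_le_sum fun _ _ => h _) (by positivity)

lemma empMean_add_mul (f g : ℝ → ℝ) (c : ℝ) :
    empMean x I (fun y => f y + c * g y) = empMean x I f + c * empMean x I g := by
  simp only [empMean, Finset.sum_add_distrib, ← Finset.mul_sum]
  ring

/-- The functional lies above its right tangents. -/
lemma right_tangent_le_empPhi {α : ℝ} (hα : 0 < α) (s t : ℝ) :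
    empPhi α x I s + (t - s) * (1 - empFreq x I (Ioi s) / α) ≤ empPhi α x I t := by
  -- Pointwise convexity: minus the indicator of y > s is a subgradient of t ↦ (y - t)₊ at s, and
  -- likewise with y ≥ s for the left tangent.
  have h : empMean x I (fun y => max (y - s) 0 + (s - t) * (Ioi s).indicator (fun _ => 1) y) ≤
      empMean x I fun y => max (y - t) 0 := by
    refine empMean_mono fun y => ?_
    by_cases hy : y ∈ Ioi s
    · rw [indicator_of_mem hy, max_eq_left (by linarith [mem_Ioi.1 hy])]
      linarith [le_max_left (y - t) 0]
    · rw [indicator_of_notMem hy, max_eq_right (by linarith [notMem_Ioi.1 hy])]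
      linarith [le_max_right (y - t) 0]
  rw [empMean_add_mul] at h
  have h' := mul_le_mul_of_nonneg_left h (one_div_nonneg.2 hα.le)
  simp only [empPhi, empFreq]
  calc _ = t + 1 / α * (empMean x I (fun y => max (y - s) 0) +
        (s - t) * empMean x I ((Ioi s).indicator fun _ => 1)) := by ring
    _ ≤ _ := by linarith

/-- The functional lies above its left tangents. -/
lemma left_tangent_le_empPhi {α : ℝ} (hα : 0 < α) (s t : ℝ) :
    empPhi α x I s + (s - t) * (empFreq x I (Ici s) / α - 1) ≤ empPhi α x I t := by
  have h : empMean x I (fun y => max (y - s) 0 + (s - t) * (Ici s).indicator (fun _ => 1) y) ≤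
      empMean x I fun y => max (y - t) 0 := by
    refine empMean_mono fun y => ?_
    by_cases hy : y ∈ Ici s
    · rw [indicator_of_mem hy, max_eq_left (by linarith [mem_Ici.1 hy])]
      linarith [le_max_left (y - t) 0]
    · rw [indicator_of_notMem hy, max_eq_right (by linarith [notMem_Ici.1 hy])]
      linarith [le_max_right (y - t) 0]
  rw [empMean_add_mul] at h
  have h' := mul_le_mul_of_nonneg_left h (one_div_nonneg.2 hα.le)
  simp only [empPhi, empFreq]
  calc _ = t + 1 / α * (empMean x I (fun y => max (y - s) 0) +
        (s - t) * empMean x I ((Ici s).indicator fun _ => 1)) := by ring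
    _ ≤ _ := by linarith

/-- If the empirical frequencies of the tails at `q` and at two nearby points are close to `α`,
then `q` almost minimizes the functional. -/
lemma empPhi_sub_le {α δ η q tm tp : ℝ} (hα : 0 < α) (hδ : 0 ≤ δ)
    (hm : tm ≤ q) (hp : q ≤ tp) (hm' : q - tm ≤ η) (hp' : tp - q ≤ η)
    (h1 : empFreq x I (Ioi tp) ≤ α) (h2 : empFreq x I (Ioi q) ≤ α + δ)
    (h3 : α - δ ≤ empFreq x I (Ici q)) (h4 : α ≤ empFreq x I (Ici tm)) (t : ℝ) :
    empPhi α x I q - η * (δ / α) ≤ empPhi α x I t := by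
  have hδα : 0 ≤ δ / α := by positivity
  have hright : ∀ s, q ≤ s → s ≤ tp → empPhi α x I q - η * (δ / α) ≤ empPhi α x I s := by
    intro s hs hs'
    have h := right_tangent_le_empPhi (x := x) (I := I) hα q s
    have h2' : -(δ / α) ≤ 1 - empFreq x I (Ioi q) / α := by
      have : empFreq x I (Ioi q) / α ≤ (α + δ) / α := by gcongr
      rw [add_div, div_self hα.ne'] at this
      linarith
    nlinarith [mul_le_mul_of_nonneg_left h2' (sub_nonneg.2 hs),
      mul_le_mul_of_nonneg_right (show s - q ≤ η by linarith) hδα]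
  have hleft : ∀ s, s ≤ q → tm ≤ s → empPhi α x I q - η * (δ / α) ≤ empPhi α x I s := by
    intro s hs hs'
    have h := left_tangent_le_empPhi (x := x) (I := I) hα q s
    have h3' : -(δ / α) ≤ empFreq x I (Ici q) / α - 1 := by
      have : (α - δ) / α ≤ empFreq x I (Ici q) / α := by gcongr
      rw [sub_div, div_self hα.ne'] at this
      linarith
    nlinarith [mul_le_mul_of_nonneg_left h3' (sub_nonneg.2 hs),
      mul_le_mul_of_nonneg_right (show q - s ≤ η by linarith) hδα]
  -- Between `tm` and `tp`, the tangents at q lose at most η · δ/α. Beyond these points the tangents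
  -- at `tm` and `tp` rise outwards, so nothing more is lost.
  rcases le_total q t with hqt | hqt
  · rcases le_total t tp with ht | ht
    · exact hright t hqt ht
    · have h := right_tangent_le_empPhi (x := x) (I := I) hα tp t
      have h1' : empFreq x I (Ioi tp) / α ≤ 1 := (div_le_one hα).2 h1
      nlinarith [hright tp hp le_rfl, mul_nonneg (sub_nonneg.2 ht) (sub_nonneg.2 h1')]
  · rcases le_total tm t with ht | ht
    · exact hleft t hqt ht
    · have h := left_tangent_le_empPhi (x := x) (I := I) hα tm t
      have h4' : 1 ≤ empFreq x I (Ici tm) / α := (one_le_div hα).2 h4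
      nlinarith [hleft tm hm le_rfl, mul_nonneg (sub_nonneg.2 ht) (sub_nonneg.2 h4')]

end Empirical

/-! ### σ_ES as the scaled standard deviation of the excess -/

section Variance

/-- Both sides are the length of [x, y) ∩ [q, ∞); for y < x the truncation in `ENNReal.ofReal` gives
0. -/
lemma lintegral_indicator_Ico_Ici (q x y : ℝ) :
    ∫⁻ s in Ici q, (Ico x y).indicator (fun _ => (1 : ℝ≥0∞)) s =
      ENNReal.ofReal (max (y - q) 0 - max (x - q) 0) := by
  rw [lintegral_indicator_const measurableSet_Ico, one_mul,
    Measure.restrict_apply measurableSet_Ico]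
  have : Ico x y ∩ Ici q = Ico (max x q) y := by
    ext s
    simp only [mem_inter_iff, mem_Ico, mem_Ici, max_le_iff]
    tauto
  rw [this, Real.volume_Ico]
  rcases le_total y q with h | h
  · rw [max_eq_right (by linarith : y - q ≤ 0), ENNReal.ofReal_of_nonpos,
      ENNReal.ofReal_of_nonpos]
    · linarith [le_max_right (x - q) 0]
    · linarith [le_max_right x q]
  · rw [max_eq_left (by linarith : 0 ≤ y - q)]
    congr 1
    rcases le_total x q with hx | hx
    · rw [max_eq_right hx, max_eq_right (by linarith)]; ring
    · rw [max_eq_left hx, max_eq_left (by linarith)]; ring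

variable (μ : Measure ℝ) [IsProbabilityMeasure μ]

lemma measurable_indicator_Ico :
    Measurable fun p : (ℝ × ℝ) × ℝ => (Ico p.1.1 p.1.2).indicator (fun _ => (1 : ℝ≥0∞)) p.2 := by
  have h : MeasurableSet {p : (ℝ × ℝ) × ℝ | p.1.1 ≤ p.2 ∧ p.2 < p.1.2} :=
    (measurableSet_le measurable_fst.fst measurable_snd).inter
      (measurableSet_lt measurable_snd measurable_fst.snd)
  exact (measurable_const (a := (1 : ℝ≥0∞))).indicator h

/-- The interval [x, y) contains s and t exactly when x ≤ min and y > max; by independence this has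
probability F(min)(1 - F(max)). -/
lemma lintegral_indicator_Ico_mul (s t : ℝ) :
    ∫⁻ p, (Ico p.1 p.2).indicator (fun _ => (1 : ℝ≥0∞)) s *
        (Ico p.1 p.2).indicator (fun _ => (1 : ℝ≥0∞)) t ∂(μ.prod μ) =
      ENNReal.ofReal (cdf μ (min t s) - cdf μ t * cdf μ s) := by
  have h : (fun p : ℝ × ℝ => (Ico p.1 p.2).indicator (fun _ => (1 : ℝ≥0∞)) s *
      (Ico p.1 p.2).indicator (fun _ => (1 : ℝ≥0∞)) t) =
      (Iic (min t s) ×ˢ Ioi (max t s)).indicator fun _ => 1 := by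
    funext p
    simp only [indicator_apply, mem_Ico, mem_prod, mem_Iic, mem_Ioi, le_min_iff, max_lt_iff]
    split_ifs <;> simp_all
  rw [h, lintegral_indicator_const (measurableSet_Iic.prod measurableSet_Ioi), one_mul,
    Measure.prod_prod, ← ofReal_cdf, ← compl_Iic, prob_compl_eq_one_sub measurableSet_Iic,
    ← ofReal_cdf, ← ENNReal.ofReal_one, ← ENNReal.ofReal_sub _ (cdf_nonneg μ _),
    ← ENNReal.ofReal_mul (cdf_nonneg μ _)]
  congr 1
  rcases le_total t s with hts | hts
  · rw [min_eq_left hts, max_eq_right hts]; ring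
  · rw [min_eq_right hts, max_eq_left hts]; ring

/-- Hoeffding's formula for the variance of the excess over a threshold. -/
lemma lintegral_sq_excess_sub (q : ℝ) :
    ∫⁻ p, ENNReal.ofReal (max (p.2 - q) 0 - max (p.1 - q) 0) ^ 2 ∂(μ.prod μ) =
      ∫⁻ s in Ici q, ∫⁻ t in Ici q,
        ENNReal.ofReal (cdf μ (min t s) - cdf μ t * cdf μ s) := by
  let h : ℝ × ℝ → ℝ → ℝ≥0∞ := fun p s => (Ico p.1 p.2).indicator (fun _ => (1 : ℝ≥0∞)) s
  have hm : Measurable (Function.uncurry h) := measurable_indicator_Ico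
  have hm1 : ∀ p, Measurable (h p) := fun p => hm.comp (f := fun s => (p, s)) (by fun_prop)
  have hm2 : ∀ s, Measurable fun p => h p s := fun s => hm.comp (f := fun p => (p, s)) (by fun_prop)
  calc ∫⁻ p, ENNReal.ofReal (max (p.2 - q) 0 - max (p.1 - q) 0) ^ 2 ∂(μ.prod μ)
      = ∫⁻ p, (∫⁻ s in Ici q, ∫⁻ t in Ici q, h p s * h p t) ∂(μ.prod μ) := by
        refine lintegral_congr fun p => ?_
        simp_rw [lintegral_const_mul _ (hm1 p)]
        rw [lintegral_mul_const _ (hm1 p), ← lintegral_indicator_Ico_Ici q p.1 p.2, sq]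
    _ = ∫⁻ s in Ici q, ∫⁻ p, (∫⁻ t in Ici q, h p s * h p t) ∂(μ.prod μ) := by
        rw [lintegral_lintegral_swap]
        refine Measurable.aemeasurable ?_
        have : Measurable fun z : ((ℝ × ℝ) × ℝ) × ℝ => h z.1.1 z.1.2 * h z.1.1 z.2 :=
          (hm.comp (f := fun z : ((ℝ × ℝ) × ℝ) × ℝ => (z.1.1, z.1.2)) (by fun_prop)).mul
            (hm.comp (f := fun z : ((ℝ × ℝ) × ℝ) × ℝ => (z.1.1, z.2)) (by fun_prop))
        exact this.lintegral_prod_right'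
    _ = ∫⁻ s in Ici q, ∫⁻ t in Ici q, ∫⁻ p, h p s * h p t ∂(μ.prod μ) := by
        refine lintegral_congr fun s => ?_
        rw [lintegral_lintegral_swap]
        refine Measurable.aemeasurable ?_
        exact (hm.comp (f := fun z : (ℝ × ℝ) × ℝ => (z.1, s)) (by fun_prop)).mul
            (hm.comp (f := fun z : (ℝ × ℝ) × ℝ => (z.1, z.2)) (by fun_prop))
    _ = _ := by simp_rw [h, lintegral_indicator_Ico_mul μ]

lemma lintegral_sq_excess_sub_eq_sigmaSq {α : ℝ} (hα : 0 < α) :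
    ∫⁻ p, ENNReal.ofReal (max (p.2 - VaR (cdf μ) (1 - α)) 0 -
        max (p.1 - VaR (cdf μ) (1 - α)) 0) ^ 2 ∂(μ.prod μ) =
      ENNReal.ofReal (α ^ 2) * sigmaSq α (cdf μ) := by
  rw [lintegral_sq_excess_sub, sigmaSq, ← mul_assoc, ← ENNReal.ofReal_mul (by positivity),
    mul_one_div_cancel (by positivity), ENNReal.ofReal_one, one_mul]

variable {μ}

/-- A nonnegative random variable whose symmetrization is square integrable is square
integrable. -/
lemma memLp_two_of_lintegral_sq_sub_ne_top {Y : ℝ → ℝ} (hY : Measurable Y) (hY0 : ∀ x, 0 ≤ Y x)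
    (h : ∫⁻ p, ENNReal.ofReal (Y p.2 - Y p.1) ^ 2 ∂(μ.prod μ) ≠ ⊤) : MemLp Y 2 μ := by
  rw [lintegral_prod _ (by fun_prop)] at h
  -- Tonelli provides one x for which the positive part of Y - Y x is square integrable, and Y is at
  -- most this part plus the constant Y x.
  obtain ⟨x, hx⟩ := (ae_lt_top' (Measurable.aemeasurable (by
    have : Measurable fun p : ℝ × ℝ => ENNReal.ofReal (Y p.2 - Y p.1) ^ 2 := by fun_prop
    exact this.lintegral_prod_right')) h).exists
  have h1 : MemLp (fun y => max (Y y - Y x) 0) 2 μ := by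
    refine (memLp_two_iff_integrable_sq (by fun_prop)).2 ⟨by fun_prop, ?_⟩
    rw [hasFiniteIntegral_iff_ofReal (ae_of_all _ fun _ => sq_nonneg _)]
    convert hx using 3 with y
    rw [ENNReal.ofReal_pow (le_max_right _ _)]
    rcases le_total (Y y - Y x) 0 with h0 | h0
    · rw [max_eq_right h0, ENNReal.ofReal_of_nonpos h0, ENNReal.ofReal_zero]
    · rw [max_eq_left h0]
  refine (h1.add (memLp_const (Y x))).mono' hY.aestronglyMeasurable (ae_of_all _ fun y => ?_)
  rw [Real.norm_of_nonneg (hY0 y)]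
  simp only [Pi.add_apply]
  linarith [le_max_left (Y y - Y x) 0]

/-- Two independent copies satisfy E(Y' - Y)² = 2 Var Y; exchanging them shows that the positive
part carries exactly half. -/
lemma ofReal_variance_eq_lintegral_sq_sub {Y : ℝ → ℝ} (hY : Measurable Y) (h2 : MemLp Y 2 μ) :
    ENNReal.ofReal (variance Y μ) =
      ∫⁻ p, ENNReal.ofReal (Y p.2 - Y p.1) ^ 2 ∂(μ.prod μ) := by
  have hi : Integrable Y μ := h2.integrable one_le_two
  have hsq : Integrable (fun x => Y x ^ 2) μ := h2.integrable_sq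
  have hsnd : Integrable (fun p : ℝ × ℝ => Y p.2 ^ 2) (μ.prod μ) := hsq.comp_snd μ
  have hfst : Integrable (fun p : ℝ × ℝ => Y p.1 ^ 2) (μ.prod μ) := hsq.comp_fst μ
  have hmul : Integrable (fun p : ℝ × ℝ => Y p.1 * Y p.2) (μ.prod μ) := hi.mul_prod hi
  have hdiff : Integrable (fun p : ℝ × ℝ => (Y p.2 - Y p.1) ^ 2) (μ.prod μ) := by
    refine ((hsnd.add hfst).sub (hmul.const_mul 2)).congr (ae_of_all _ fun p => ?_)
    simp only [Pi.add_apply, Pi.sub_apply]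
    ring
  have hint : ∫ p, (Y p.2 - Y p.1) ^ 2 ∂(μ.prod μ) = 2 * variance Y μ := by
    calc ∫ p, (Y p.2 - Y p.1) ^ 2 ∂(μ.prod μ)
        = ∫ p, (Y p.2 ^ 2 + Y p.1 ^ 2 - 2 * (Y p.1 * Y p.2)) ∂(μ.prod μ) := by
          congr 1 with p
          ring
      _ = 2 * variance Y μ := by
          rw [integral_sub (f := fun p : ℝ × ℝ => Y p.2 ^ 2 + Y p.1 ^ 2) (hsnd.add hfst) (hmul.const_mul 2), integral_add hsnd hfst,
            integral_const_mul, integral_prod_mul, integral_fun_snd (fun x => Y x ^ 2),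
            integral_fun_fst (fun x => Y x ^ 2), variance_eq_sub h2]
          simp
          ring
  have hswap : ∫⁻ p, ENNReal.ofReal (Y p.1 - Y p.2) ^ 2 ∂(μ.prod μ) =
      ∫⁻ p, ENNReal.ofReal (Y p.2 - Y p.1) ^ 2 ∂(μ.prod μ) :=
    lintegral_prod_swap (fun p : ℝ × ℝ => ENNReal.ofReal (Y p.2 - Y p.1) ^ 2)
  have hsum : 2 * ∫⁻ p, ENNReal.ofReal (Y p.2 - Y p.1) ^ 2 ∂(μ.prod μ) =
      2 * ENNReal.ofReal (variance Y μ) := by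
    calc 2 * ∫⁻ p, ENNReal.ofReal (Y p.2 - Y p.1) ^ 2 ∂(μ.prod μ)
        = ∫⁻ p, (ENNReal.ofReal (Y p.2 - Y p.1) ^ 2 + ENNReal.ofReal (Y p.1 - Y p.2) ^ 2)
            ∂(μ.prod μ) := by
          rw [lintegral_add_left (by fun_prop), hswap, two_mul]
      _ = ∫⁻ p, ENNReal.ofReal ((Y p.2 - Y p.1) ^ 2) ∂(μ.prod μ) := by
          refine lintegral_congr fun p => ?_
          rcases le_total (Y p.1) (Y p.2) with h | h
          · rw [ENNReal.ofReal_of_nonpos (sub_nonpos.2 h), ENNReal.ofReal_pow (sub_nonneg.2 h)]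
            simp
          · rw [ENNReal.ofReal_of_nonpos (sub_nonpos.2 h), ← neg_sq (Y p.2 - Y p.1), neg_sub,
              ENNReal.ofReal_pow (sub_nonneg.2 h)]
            simp
      _ = ENNReal.ofReal (2 * variance Y μ) := by
          rw [← hint, ofReal_integral_eq_lintegral_ofReal hdiff (ae_of_all _ fun _ => sq_nonneg _)]
      _ = 2 * ENNReal.ofReal (variance Y μ) := by
          rw [ENNReal.ofReal_mul zero_le_two, ENNReal.ofReal_ofNat]
  exact ((ENNReal.mul_right_inj two_ne_zero ENNReal.ofNat_ne_top).1 hsum).symm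

/-- The excess over the value at risk is square integrable as soon as `σ_ES` is finite. -/
lemma memLp_excess {α : ℝ} (hα : 0 < α) (h : sigmaSq α (cdf μ) ≠ ⊤) :
    MemLp (fun x => max (x - VaR (cdf μ) (1 - α)) 0) 2 μ := by
  refine memLp_two_of_lintegral_sq_sub_ne_top (by fun_prop) (fun _ => le_max_right _ _) ?_
  rw [lintegral_sq_excess_sub_eq_sigmaSq μ hα]
  exact ENNReal.mul_ne_top ENNReal.ofReal_ne_top h

lemma variance_excess {α : ℝ} (hα : 0 < α) (h : sigmaSq α (cdf μ) ≠ ⊤) :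
    variance (fun x => max (x - VaR (cdf μ) (1 - α)) 0) μ = α ^ 2 * sigma α (cdf μ) ^ 2 := by
  have h1 := ofReal_variance_eq_lintegral_sq_sub (by fun_prop) (memLp_excess hα h)
  rw [lintegral_sq_excess_sub_eq_sigmaSq μ hα] at h1
  have h2 := congrArg ENNReal.toReal h1
  rw [ENNReal.toReal_ofReal (variance_nonneg _ _), ENNReal.toReal_mul,
    ENNReal.toReal_ofReal (by positivity)] at h2
  rw [h2, sigma, Real.sq_sqrt ENNReal.toReal_nonneg]

end Variance

/-! ### Chebyshev on one block, Hoeffding across blocks -/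

section Concentration

variable {N : ℕ} (μ : Measure ℝ) [IsProbabilityMeasure μ] {I : Finset (Fin N)}

lemma memLp_comp_eval {f : ℝ → ℝ} (hf : MemLp f 2 μ) (i : Fin N) :
    MemLp (fun x : Fin N → ℝ => f (x i)) 2 (Measure.pi fun _ => μ) :=
  hf.comp_measurePreserving (measurePreserving_eval (fun _ => μ) i)

lemma iIndepFun_eval : iIndepFun (fun (i : Fin N) (x : Fin N → ℝ) => x i)
    (Measure.pi fun _ => μ) :=
  iIndepFun_pi (X := fun _ => id) fun _ => aemeasurable_id

lemma memLp_empMean {f : ℝ → ℝ} (hf : MemLp f 2 μ) :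
    MemLp (fun x : Fin N → ℝ => empMean x I f) 2 (Measure.pi fun _ => μ) :=
  (memLp_finsetSum I fun i _ => memLp_comp_eval μ hf i).const_mul _

lemma integral_comp_eval {f : ℝ → ℝ} (hf : Measurable f) (i : Fin N) :
    ∫ x : Fin N → ℝ, f (x i) ∂(Measure.pi fun _ => μ) = ∫ y, f y ∂μ := by
  conv_rhs => rw [← (measurePreserving_eval (fun _ : Fin N => μ) i).map_eq]
  exact (integral_map (measurable_pi_apply i).aemeasurable hf.aestronglyMeasurable).symm

lemma integral_empMean (hI : I.Nonempty) {f : ℝ → ℝ} (hfm : Measurable f) (hf : MemLp f 2 μ) :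
    ∫ x : Fin N → ℝ, empMean x I f ∂(Measure.pi fun _ => μ) = ∫ y, f y ∂μ := by
  simp only [empMean]
  rw [integral_const_mul,
    integral_finsetSum _ fun i _ => (memLp_comp_eval μ hf i).integrable one_le_two]
  simp only [integral_comp_eval μ hfm, Finset.sum_const, nsmul_eq_mul]
  rw [← mul_assoc, one_div_mul_cancel (by simpa using hI.ne_empty), one_mul]

lemma variance_empMean (hI : I.Nonempty) {f : ℝ → ℝ} (hfm : Measurable f) (hf : MemLp f 2 μ) :
    variance (fun x : Fin N → ℝ => empMean x I f) (Measure.pi fun _ => μ) =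
      variance f μ / I.card := by
  have h0 : (I.card : ℝ) ≠ 0 := by simpa using hI.ne_empty
  have h1 : variance (∑ i ∈ I, fun x : Fin N → ℝ => f (x i)) (Measure.pi fun _ => μ) =
      I.card * variance f μ := by
    rw [IndepFun.variance_sum (fun i _ => memLp_comp_eval μ hf i)]
    · rw [← nsmul_eq_mul, ← Finset.sum_const]
      refine Finset.sum_congr rfl fun i _ => ?_
      exact (measurePreserving_eval (fun _ => μ) i).variance_fun_comp hfm.aemeasurable
    · intro i _ j _ hij
      exact ((iIndepFun_eval μ).indepFun hij).comp hfm hfm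
  simp only [empMean]
  rw [variance_const_mul]
  have h2 : (fun x : Fin N → ℝ => ∑ i ∈ I, f (x i)) = ∑ i ∈ I, fun x : Fin N → ℝ => f (x i) := by
    ext x; simp
  rw [h2, h1]
  field_simp

/-- Chebyshev's inequality for the average over a subsample. -/
lemma measure_le_abs_empMean_sub (hI : I.Nonempty) {f : ℝ → ℝ} (hfm : Measurable f)
    (hf : MemLp f 2 μ) {c : ℝ} (hc : 0 < c) :
    (Measure.pi fun _ => μ).real {x : Fin N → ℝ | c ≤ |empMean x I f - ∫ y, f y ∂μ|} ≤
      variance f μ / (I.card * c ^ 2) := by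
  have h := meas_ge_le_variance_div_sq (memLp_empMean (I := I) μ hf) hc
  rw [integral_empMean μ hI hfm hf, variance_empMean μ hI hfm hf, div_div] at h
  exact ENNReal.toReal_le_of_le_ofReal (by have := variance_nonneg f μ; positivity) h

/-- The variance of an indicator is at most its mean. Keeping this factor, of order α in the
application, is what permits δ of order ε√α. -/
lemma measure_le_abs_empFreq_sub (hI : I.Nonempty) {A : Set ℝ} (hA : MeasurableSet A) {c : ℝ}
    (hc : 0 < c) :
    (Measure.pi fun _ => μ).real {x : Fin N → ℝ | c ≤ |empFreq x I A - μ.real A|} ≤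
      μ.real A / (I.card * c ^ 2) := by
  have hm : Measurable (A.indicator fun _ => (1 : ℝ)) := measurable_const.indicator hA
  have hL : MemLp (A.indicator fun _ => (1 : ℝ)) 2 μ := (memLp_const 1).indicator hA
  have h := measure_le_abs_empMean_sub μ hI hm hL hc
  have hint : ∫ y, A.indicator (fun _ => (1 : ℝ)) y ∂μ = μ.real A := integral_indicator_one hA
  rw [hint] at h
  refine h.trans ?_
  gcongr
  refine (variance_le_expectation_sq hL.aestronglyMeasurable).trans_eq ?_
  rw [← hint]
  congr 1 with y
  by_cases hy : y ∈ A <;> simp [hy]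

lemma measure_lt_empFreq (hI : I.Nonempty) {A : Set ℝ} (hA : MeasurableSet A) {a δ : ℝ}
    (ha : μ.real A ≤ a) (hδ : 0 < δ) :
    (Measure.pi fun _ => μ).real {x : Fin N → ℝ | a + δ < empFreq x I A} ≤
      a / (I.card * δ ^ 2) := by
  calc _ ≤ (Measure.pi fun _ => μ).real {x : Fin N → ℝ | δ ≤ |empFreq x I A - μ.real A|} := by
        refine measureReal_mono fun x (hx : a + δ < _) => ?_
        exact le_trans (b := empFreq x I A - μ.real A) (by linarith) (le_abs_self _)
    _ ≤ μ.real A / (I.card * δ ^ 2) := measure_le_abs_empFreq_sub μ hI hA hδ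
    _ ≤ _ := by gcongr

/-- The true probability p may exceed a, which raises the variance but also the required deviation,
to p - a + δ. For δ ≤ 2a the latter wins: pδ² ≤ a(p - a + δ)². -/
lemma measure_empFreq_lt (hI : I.Nonempty) {A : Set ℝ} (hA : MeasurableSet A) {a δ : ℝ}
    (ha : a ≤ μ.real A) (hδ : 0 < δ) (hδa : δ ≤ 2 * a) :
    (Measure.pi fun _ => μ).real {x : Fin N → ℝ | empFreq x I A < a - δ} ≤
      a / (I.card * δ ^ 2) := by
  have hr : 0 < μ.real A - a + δ := by linarith
  have hcard : (0 : ℝ) < I.card := by exact_mod_cast hI.card_pos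
  calc _ ≤ (Measure.pi fun _ => μ).real
          {x : Fin N → ℝ | μ.real A - a + δ ≤ |empFreq x I A - μ.real A|} := by
        refine measureReal_mono fun x (hx : _ < a - δ) => ?_
        exact le_trans (b := -(empFreq x I A - μ.real A)) (by linarith) (neg_le_abs _)
    _ ≤ μ.real A / (I.card * (μ.real A - a + δ) ^ 2) := measure_le_abs_empFreq_sub μ hI hA hr
    _ ≤ _ := by
        rw [div_le_div_iff₀ (by positivity) (by positivity)]
        have h1 : μ.real A * δ ^ 2 ≤ a * (μ.real A - a + δ) ^ 2 := by
          nlinarith [mul_nonneg (mul_nonneg (sub_nonneg.2 ha) hδ.le) (sub_nonneg.2 hδa),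
            mul_nonneg (show 0 ≤ a by linarith) (sq_nonneg (μ.real A - a))]
        nlinarith [mul_le_mul_of_nonneg_left h1 hcard.le]

/-- Padding by zeros (`e`) factors each function through its own coordinates, and disjoint
coordinate families are independent. -/
lemma indepFun_of_dependsOn {S T : Finset (Fin N)} (hST : Disjoint S T) {f g : (Fin N → ℝ) → ℝ}
    (hf : Measurable f) (hg : Measurable g) (hfS : DependsOn f S) (hgT : DependsOn g T) :
    IndepFun f g (Measure.pi fun _ => μ) := by
  let e : (S : Finset (Fin N)) → (S → ℝ) → Fin N → ℝ :=
    fun S y i => if h : i ∈ S then y ⟨i, h⟩ else 0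
  have he : ∀ S, Measurable (e S) := by
    refine fun S => measurable_pi_lambda _ fun i => ?_
    by_cases h : i ∈ S
    · simpa [e, h] using measurable_pi_apply (⟨i, h⟩ : S)
    · simp [e, h]
  have key : ∀ (S : Finset (Fin N)) (f : (Fin N → ℝ) → ℝ), DependsOn f S →
      f = (f ∘ e S) ∘ fun x (i : S) => x i := by
    intro S f hf
    funext x
    refine hf fun i hi => ?_
    simp [e, Finset.mem_coe.1 hi]
  have h := (iIndepFun_eval μ).indepFun_finset S T hST fun i => measurable_pi_apply i
  rw [key S f hfS, key T g hgT]
  exact h.comp (hf.comp (he S)) (hg.comp (he T))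

/-- Hoeffding's inequality for bounded functions of disjoint blocks of coordinates. -/
lemma hasSubgaussianMGF_sum_of_dependsOn {ι : Type*} {J : ι → Finset (Fin N)}
    (hJ : Pairwise fun i j => Disjoint (J i) (J j)) {B : ι → (Fin N → ℝ) → ℝ}
    (hBm : ∀ j, Measurable (B j)) (hB : ∀ j x, B j x ∈ Icc (0 : ℝ) 1)
    (hBJ : ∀ j, DependsOn (B j) (J j)) (S : Finset ι) :
    HasSubgaussianMGF
      (fun x => ∑ j ∈ S, (B j x - ∫ y, B j y ∂(Measure.pi fun _ => μ))) ((S.card : ℝ≥0) / 4)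
      (Measure.pi fun _ => μ) := by
  classical
  induction S using Finset.induction_on with
  | empty => simp
  | insert j S hj ih =>
    simp only [Finset.sum_insert hj, Finset.card_insert_of_notMem hj]
    have h1 := hasSubgaussianMGF_of_mem_Icc (μ := Measure.pi fun _ : Fin N => μ)
      (hBm j).aemeasurable (ae_of_all _ (hB j))
    have h2 := h1.add_of_indepFun ih ?_
    · convert h2 using 1
      ext
      push_cast
      simp
      ring
    · refine indepFun_of_dependsOn μ (S := J j) (T := S.biUnion J) ?_ (by fun_prop)
        (Finset.measurable_sum _ fun i _ => (hBm i).sub_const _) ?_ ?_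
      · rw [Finset.disjoint_biUnion_right]
        exact fun i hi => hJ fun h => hj (h ▸ hi)
      · intro x y hxy
        simp only [hBJ j hxy]
      · intro x y hxy
        refine Finset.sum_congr rfl fun i hi => ?_
        rw [hBJ i fun k hk => hxy k (Finset.mem_coe.2 (Finset.mem_biUnion.2 ⟨i, hi, hk⟩))]

end Concentration

/-! ### Robustness of central quantiles -/

section OrderStatistics

variable {n : ℕ}

/-- If the value of rank k were at most a, then it and the k values before it would all be
exceptional, which is more than `s` can hold; symmetrically at b with the n - k largest. -/
lemma orderStat_mem_Ioo {T : Fin n → ℝ} {a b : ℝ} {s : Finset (Fin n)}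
    (hT : ∀ j ∉ s, T j ∈ Ioo a b) {k : ℕ} (hk : s.card ≤ k) (hkn : k + s.card < n) :
    orderStat T k ∈ Ioo a b := by
  have hn : k < n := by omega
  have hmono : Monotone (T ∘ Tuple.sort T) := Tuple.monotone_sort T
  rw [orderStat, dif_pos hn]
  constructor
  · by_contra! h
    have hsub : (Finset.Iic (⟨k, hn⟩ : Fin n)).map (Tuple.sort T).toEmbedding ⊆ s := by
      intro j hj
      obtain ⟨i, hi, rfl⟩ := Finset.mem_map.1 hj
      by_contra hs
      exact absurd (hT _ hs).1 (not_lt.2 ((hmono (Finset.mem_Iic.1 hi)).trans h))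
    have hcard := Finset.card_le_card hsub
    rw [Finset.card_map, Fin.card_Iic] at hcard
    simp only at hcard
    omega
  · by_contra! h
    have hsub : (Finset.Ici (⟨k, hn⟩ : Fin n)).map (Tuple.sort T).toEmbedding ⊆ s := by
      intro j hj
      obtain ⟨i, hi, rfl⟩ := Finset.mem_map.1 hj
      by_contra hs
      exact absurd (hT _ hs).2 (not_lt.2 (h.trans (hmono (Finset.mem_Ici.1 hi))))
    have hcard := Finset.card_le_card hsub
    rw [Finset.card_map, Fin.card_Ici] at hcard
    simp only at hcard
    omega

/-- If fewer than a quarter of the values lie outside an interval, then the central empirical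
quantiles lie in this interval. -/
lemma interpQuantile_mem_Ioo {T : Fin n → ℝ} {a b β : ℝ} {s : Finset (Fin n)}
    (hT : ∀ j ∉ s, T j ∈ Ioo a b) (hs : 4 * s.card < n) (hn : 20 ≤ n)
    (hβ : 0.35 ≤ β) (hβ' : β ≤ 0.65) : interpQuantile T β ∈ Ioo a b := by
  have hnR : (20 : ℝ) ≤ n := by exact_mod_cast hn
  have hsR : 4 * (s.card : ℝ) < n := by exact_mod_cast hs
  norm_num at hβ hβ'
  simp only [interpQuantile]
  set h : ℝ := ((n : ℝ) - 1) * β with hh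
  have h_low : ((n : ℝ) - 1) * (7 / 20) ≤ h := mul_le_mul_of_nonneg_left hβ (by linarith)
  have h_up : h ≤ ((n : ℝ) - 1) * (13 / 20) := mul_le_mul_of_nonneg_left hβ' (by linarith)
  have hk1 : (⌊h⌋₊ : ℝ) ≤ h := Nat.floor_le (by linarith)
  have hk2 : h < ⌊h⌋₊ + 1 := Nat.lt_floor_add_one h
  -- The floor costs at most one, and n/4 ≤ 0.35(n - 1) - 1 already for n ≥ 14. Interpolation also
  -- uses rank k + 1, hence the extra 1 in `h2`.
  have h1 : s.card ≤ ⌊h⌋₊ := by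
    have : (s.card : ℝ) ≤ ⌊h⌋₊ := by linarith
    exact_mod_cast this
  have h2 : ⌊h⌋₊ + 1 + s.card < n := by
    have : (⌊h⌋₊ : ℝ) + 1 + s.card < n := by linarith
    exact_mod_cast this
  have hA := orderStat_mem_Ioo hT h1 (by omega)
  have hB := orderStat_mem_Ioo hT (h1.trans (Nat.le_succ _)) h2
  have := (convex_Ioo a b) hA hB (a := 1 - (h - ⌊h⌋₊)) (b := h - ⌊h⌋₊) (by linarith)
    (by linarith) (by ring)
  simp only [smul_eq_mul] at this
  convert this using 1
  ring

end OrderStatistics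

/-! ### Size and disjointness of blocks -/

section Blocks

variable {N : ℕ}

lemma card_block {m j : ℕ} (h : (j + 1) * m ≤ N) : (block N m j).card = m := by
  have : (block N m j).map Fin.valEmbedding = Finset.Ico (j * m) ((j + 1) * m) := by
    ext i
    simp only [block, Finset.mem_map, Finset.mem_filter, Finset.mem_univ, true_and,
      Fin.valEmbedding_apply, Finset.mem_Ico]
    exact ⟨fun ⟨k, hk, hki⟩ => hki ▸ hk, fun hi => ⟨⟨i, hi.2.trans_le h⟩, hi, rfl⟩⟩
  rw [← Finset.card_map Fin.valEmbedding, this, Nat.card_Ico, add_mul, one_mul,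
    Nat.add_sub_cancel_left]

lemma disjoint_block {m j k : ℕ} (h : j ≠ k) : Disjoint (block N m j) (block N m k) := by
  rw [Finset.disjoint_left]
  intro i hi hi'
  simp only [block, Finset.mem_filter, Finset.mem_univ, true_and] at hi hi'
  rcases Nat.lt_or_gt_of_ne h with h | h
  · have := Nat.mul_le_mul_right m (Nat.succ_le_of_lt h)
    simp only [Nat.succ_eq_add_one] at this
    omega
  · have := Nat.mul_le_mul_right m (Nat.succ_le_of_lt h)
    simp only [Nat.succ_eq_add_one] at this
    omega

end Blocks

/-! ### Accuracy and probability of a good block -/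

section GoodBlocks

variable {N : ℕ}

/-- The averages over the subsample `(x i)_{i ∈ I}` that govern the plug-in estimator are close
to their expectations: the average excess up to `α * τ`, the tail frequencies up to `δ`. -/
def IsGoodSample (μ : Measure ℝ) (α δ τ : ℝ) (x : Fin N → ℝ) (I : Finset (Fin N)) : Prop :=
  |empMean x I (fun y => max (y - VaR (cdf μ) (1 - α)) 0) -
    ∫ y, max (y - VaR (cdf μ) (1 - α)) 0 ∂μ| < α * τ ∧
  empFreq x I (Ioi (VaR (cdf μ) (1 - (α - δ)))) ≤ α ∧
  empFreq x I (Ioi (VaR (cdf μ) (1 - α))) ≤ α + δ ∧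
  α - δ ≤ empFreq x I (Ici (VaR (cdf μ) (1 - α))) ∧
  α ≤ empFreq x I (Ici (VaR (cdf μ) (1 - (α + δ))))

lemma measurable_empMean {I : Finset (Fin N)} {f : ℝ → ℝ} (hf : Measurable f) :
    Measurable fun x : Fin N → ℝ => empMean x I f :=
  (Finset.measurable_sum _ fun i _ => hf.comp (measurable_pi_apply i)).const_mul _

lemma measurableSet_isGoodSample (μ : Measure ℝ) (α δ τ : ℝ) (I : Finset (Fin N)) :
    MeasurableSet {x : Fin N → ℝ | IsGoodSample μ α δ τ x I} := by
  have hf : ∀ {A : Set ℝ}, MeasurableSet A → Measurable fun x : Fin N → ℝ => empFreq x I A :=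
    fun hA => measurable_empMean (measurable_const.indicator hA)
  have he : Measurable fun x : Fin N → ℝ =>
      empMean x I fun y => max (y - VaR (cdf μ) (1 - α)) 0 := measurable_empMean (by fun_prop)
  exact (measurableSet_lt (he.sub_const _).abs measurable_const).inter <|
    (measurableSet_le (hf measurableSet_Ioi) measurable_const).inter <|
    (measurableSet_le (hf measurableSet_Ioi) measurable_const).inter <|
    (measurableSet_le measurable_const (hf measurableSet_Ici)).inter <|
    measurableSet_le measurable_const (hf measurableSet_Ici)

lemma isGoodSample_congr (μ : Measure ℝ) (α δ τ : ℝ) {I : Finset (Fin N)} {x y : Fin N → ℝ}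
    (h : ∀ i ∈ I, x i = y i) :
    IsGoodSample μ α δ τ x I ↔ IsGoodSample μ α δ τ y I := by
  have hm : ∀ f, empMean x I f = empMean y I f := by
    intro f
    rw [empMean, empMean, Finset.sum_congr rfl fun i hi => by rw [h i hi]]
  simp only [IsGoodSample, empFreq, hm]

variable {μ : Measure ℝ} [IsProbabilityMeasure μ] {α δ τ : ℝ} {I : Finset (Fin N)}

/-- On a good subsample the plug-in estimator is close to the expected shortfall. -/
lemma IsGoodSample.abs_plugIn_sub_lt {x : Fin N → ℝ} {L : ℝ≥0} (hx : IsGoodSample μ α δ τ x I)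
    (hI : I.Nonempty) (hα : 0 < α) (hα' : α < 1 / 2) (hδ : 0 < δ) (hδα : δ ≤ α / 2)
    (hσ : sigmaSq α (cdf μ) ≠ ⊤)
    (hL : LipschitzOnWith L (fun u => VaR (cdf μ) u) (Icc (1 - 2 * α) (1 - α / 2))) :
    |plugIn α x I - ES α (cdf μ)| < τ + L * δ * (δ / α) := by
  have hα1 : α ∈ Ioo (0 : ℝ) 1 := ⟨hα, by linarith⟩
  have hES := ES_eq hα1 ((memLp_excess hα hσ).integrable one_le_two)
  have hq : 1 - α ∈ Ioo (0 : ℝ) 1 := ⟨by linarith, by linarith⟩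
  have hup : 1 - (α - δ) ∈ Ioo (0 : ℝ) 1 := ⟨by linarith, by linarith⟩
  have hlo : 1 - (α + δ) ∈ Ioo (0 : ℝ) 1 := ⟨by linarith, by linarith⟩
  have hqI : 1 - α ∈ Icc (1 - 2 * α) (1 - α / 2) := ⟨by linarith, by linarith⟩
  have hupI : 1 - (α - δ) ∈ Icc (1 - 2 * α) (1 - α / 2) := ⟨by linarith, by linarith⟩
  have hloI : 1 - (α + δ) ∈ Icc (1 - 2 * α) (1 - α / 2) := ⟨by linarith, by linarith⟩
  have h1 := hL.dist_le_mul _ hupI _ hqI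
  have h2 := hL.dist_le_mul _ hqI _ hloI
  rw [Real.dist_eq, Real.dist_eq, show 1 - (α - δ) - (1 - α) = δ by ring, abs_of_pos hδ] at h1
  rw [Real.dist_eq, Real.dist_eq, show 1 - α - (1 - (α + δ)) = δ by ring, abs_of_pos hδ] at h2
  obtain ⟨t, ht⟩ := exists_plugIn_eq_empPhi (x := x) hα1 hI
  -- Here η = Lδ: since δ ≤ α/2, the levels 1 - (α ± δ) stay in the interval of Lipschitz
  -- continuity.
  have hlower := empPhi_sub_le hα hδ.le (VaR_monotoneOn μ hlo hq (by linarith))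
    (VaR_monotoneOn μ hq hup (by linarith)) ((le_abs_self _).trans h2) ((le_abs_self _).trans h1)
    hx.2.1 hx.2.2.1 hx.2.2.2.1 hx.2.2.2.2 t
  have hupper := plugIn_le_empPhi (x := x) hα1 hI (VaR (cdf μ) (1 - α))
  rw [← ht] at hlower
  have hdiff : empPhi α x I (VaR (cdf μ) (1 - α)) - ES α (cdf μ) =
      (empMean x I (fun y => max (y - VaR (cdf μ) (1 - α)) 0) -
        ∫ y, max (y - VaR (cdf μ) (1 - α)) 0 ∂μ) / α := by
    rw [hES, empPhi]
    ring
  have habs : |empPhi α x I (VaR (cdf μ) (1 - α)) - ES α (cdf μ)| < τ := by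
    rw [hdiff, abs_div, abs_of_pos hα, div_lt_iff₀ hα, mul_comm]
    exact hx.1
  have hR : 0 ≤ L * δ * (δ / α) := by positivity
  rw [abs_lt] at habs ⊢
  constructor <;> linarith [habs.1, habs.2]

/-- Chebyshev gives 1/11 for the excess and 3/550 for each of the four frequencies, whose comparison
levels are at most 3α/2; the sum is 62/550 < 0.12. -/
lemma measure_not_isGoodSample_le (hI : I.Nonempty) (hα : 0 < α) (hα' : α < 1 / 2)
    (hσ : sigmaSq α (cdf μ) ≠ ⊤) (hδ : 0 < δ) (hδα : δ ≤ α / 2) (hτ : 0 < τ)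
    (hcard : 275 * α ≤ I.card * δ ^ 2)
    (hvar : 11 * sigma α (cdf μ) ^ 2 ≤ I.card * τ ^ 2) :
    (Measure.pi fun _ => μ).real {x : Fin N → ℝ | ¬ IsGoodSample μ α δ τ x I} ≤ 0.12 := by
  have hq : 1 - α ∈ Ioo (0 : ℝ) 1 := ⟨by linarith, by linarith⟩
  have hup : 1 - (α - δ) ∈ Ioo (0 : ℝ) 1 := ⟨by linarith, by linarith⟩
  have hlo : 1 - (α + δ) ∈ Ioo (0 : ℝ) 1 := ⟨by linarith, by linarith⟩
  have hc : (0 : ℝ) < I.card := by exact_mod_cast hI.card_pos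
  have hY : Measurable fun y => max (y - VaR (cdf μ) (1 - α)) 0 := by fun_prop
  have b0 := measure_le_abs_empMean_sub μ hI hY (memLp_excess hα hσ) (mul_pos hα hτ)
  rw [variance_excess hα hσ] at b0
  have b1 := measure_lt_empFreq μ hI measurableSet_Ioi (measure_Ioi_VaR_le μ hup) hδ
  have b2 := measure_lt_empFreq μ hI measurableSet_Ioi (measure_Ioi_VaR_le μ hq) hδ
  have b3 := measure_empFreq_lt μ hI measurableSet_Ici (le_measure_Ici_VaR μ hq) hδ
    (by linarith)
  have b4 := measure_empFreq_lt μ hI measurableSet_Ici (le_measure_Ici_VaR μ hlo) hδ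
    (by linarith)
  simp only [sub_sub_cancel, sub_add_cancel, add_sub_cancel_right] at b1 b2 b3 b4
  have c0 : α ^ 2 * sigma α (cdf μ) ^ 2 / (I.card * (α * τ) ^ 2) ≤ 1 / 11 := by
    rw [div_le_div_iff₀ (by positivity) (by norm_num)]
    nlinarith [mul_le_mul_of_nonneg_left hvar (sq_nonneg α)]
  have c : ∀ a ≤ 3 / 2 * α, a / (I.card * δ ^ 2) ≤ 3 / 550 := by
    intro a ha
    rw [div_le_div_iff₀ (by positivity) (by norm_num)]
    linarith
  have hsub : {x : Fin N → ℝ | ¬ IsGoodSample μ α δ τ x I} ⊆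
      {x : Fin N → ℝ | α * τ ≤ |empMean x I (fun y => max (y - VaR (cdf μ) (1 - α)) 0) -
        ∫ y, max (y - VaR (cdf μ) (1 - α)) 0 ∂μ|} ∪
      ({x | α < empFreq x I (Ioi (VaR (cdf μ) (1 - (α - δ))))} ∪
      ({x | α + δ < empFreq x I (Ioi (VaR (cdf μ) (1 - α)))} ∪
      ({x | empFreq x I (Ici (VaR (cdf μ) (1 - α))) < α - δ} ∪
      {x | empFreq x I (Ici (VaR (cdf μ) (1 - (α + δ)))) < α}))) := by
    intro x hx
    by_contra h
    simp only [mem_union, mem_ofPred_eq, not_or, not_lt, not_le] at h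
    exact hx h
  refine (measureReal_mono hsub).trans ?_
  refine (measureReal_union_le _ _).trans ?_
  have d1 := c (α - δ) (by linarith)
  have d2 := c α (by linarith)
  have d4 := c (α + δ) (by linarith)
  refine (add_le_add (b0.trans c0) ((measureReal_union_le _ _).trans (add_le_add (b1.trans d1)
    ((measureReal_union_le _ _).trans (add_le_add (b2.trans d2)
      ((measureReal_union_le _ _).trans (add_le_add (b3.trans d2) (b4.trans d4)))))))).trans ?_
  norm_num

end GoodBlocks

/-! ### Aggregation over the blocks -/

section MedianOfBlocks

variable {N : ℕ} (μ : Measure ℝ) [IsProbabilityMeasure μ]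

/-- Among `n` events of small probability on disjoint blocks, a quarter occurs only with
exponentially small probability. -/
lemma measure_quarter_le {n : ℕ} {J : Fin n → Finset (Fin N)}
    (hJ : Pairwise fun i j => Disjoint (J i) (J j)) {A : Fin n → Set (Fin N → ℝ)}
    [∀ j x, Decidable (x ∈ A j)]
    (hA : ∀ j, MeasurableSet (A j))
    (hAJ : ∀ j x y, (∀ i ∈ J j, x i = y i) → (x ∈ A j ↔ y ∈ A j))
    (hp : ∀ j, (Measure.pi fun _ => μ).real (A j) ≤ 0.12) :
    (Measure.pi fun _ => μ).real {x | n ≤ 4 * (Finset.univ.filter fun j => x ∈ A j).card} ≤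
      Real.exp (-0.03 * n) := by
  rcases Nat.eq_zero_or_pos n with rfl | hn
  · simp
  have hn' : (0 : ℝ) < n := by exact_mod_cast hn
  have hsub := hasSubgaussianMGF_sum_of_dependsOn μ hJ
    (B := fun j => (A j).indicator fun _ => (1 : ℝ))
    (fun j => measurable_const.indicator (hA j))
    (fun j x => by by_cases hx : x ∈ A j <;> simp [hx])
    (fun j x y hxy => by
      have := hAJ j x y hxy
      by_cases hx : x ∈ A j
      · rw [indicator_of_mem hx, indicator_of_mem (this.1 hx)]
      · rw [indicator_of_notMem hx, indicator_of_notMem (fun h => hx (this.2 h))]) Finset.univ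
  -- The gap is 0.13 = 0.25 - 0.12, and the sub-Gaussian parameter n/4 gives the exponent -2 · 0.13²
  -- n = -0.0338n.
  have h := hsub.measure_ge_le (ε := 0.13 * n) (by positivity)
  refine (measureReal_mono fun x hx => ?_).trans (h.trans (Real.exp_le_exp.2 ?_))
  · have hx' : (n : ℝ) ≤ 4 * ((Finset.univ.filter fun j => x ∈ A j).card : ℝ) := by
      exact_mod_cast (show n ≤ 4 * (Finset.univ.filter fun j => x ∈ A j).card from hx)
    have hcount : ∑ j, (A j).indicator (fun _ => (1 : ℝ)) x =
        ((Finset.univ.filter fun j => x ∈ A j).card : ℝ) := by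
      simp [indicator_apply]
    have hmean : ∑ j, ∫ y, (A j).indicator (fun _ => (1 : ℝ)) y ∂(Measure.pi fun _ => μ) ≤
        0.12 * n := by
      calc _ ≤ ∑ _j : Fin n, (0.12 : ℝ) :=
            Finset.sum_le_sum fun j _ => (integral_indicator_one (hA j)).trans_le (hp j)
        _ = _ := by simp [mul_comm]
    show 0.13 * (n : ℝ) ≤ _
    rw [Finset.sum_sub_distrib, hcount]
    norm_num at hmean ⊢
    linarith
  · simp only [Finset.card_univ, Fintype.card_fin]
    push_cast
    rw [div_le_iff₀ (by positivity)]
    norm_num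
    nlinarith [mul_pos hn' hn']

/-- The deviation bound for the truncated estimator on the canonical sample space. -/
lemma exists_measurableSet_estimator_dev {α β₁ β₂ ε : ℝ} {L : ℝ≥0} (hα : 0 < α)
    (hα' : α < 1 / 2) (h₁ : 0.35 ≤ β₁) (h₁₂ : β₁ ≤ β₂) (h₂ : β₂ ≤ 0.65)
    (hσ : sigmaSq α (cdf μ) ≠ ⊤)
    (hL : LipschitzOnWith L (fun u => VaR (cdf μ) u) (Icc (1 - 2 * α) (1 - α / 2)))
    (hpos : 0 < sigma α (cdf μ) ∨ 0 < L) (hε : 0 < ε) (hεα : ε < 1 / 10 * Real.sqrt α)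
    (hN : 600 / ε ^ 2 ≤ (N : ℝ)) :
    ∃ A : Set (Fin N → ℝ), MeasurableSet A ∧
      {x | ε * sigma α (cdf μ) + 26 * (L : ℝ) * ε ^ 2 ≤
        |estimator α ε β₁ β₂ x - ES α (cdf μ)|} ⊆ A ∧
      (Measure.pi fun _ => μ).real A ≤ Real.exp (-0.001 * (N : ℝ) * ε ^ 2) := by
  classical
  set σ := sigma α (cdf μ) with hσdef
  have hσ0 : 0 ≤ σ := Real.sqrt_nonneg _
  have hsq : Real.sqrt α ^ 2 = α := Real.sq_sqrt hα.le
  have hs0 : 0 < Real.sqrt α := Real.sqrt_pos.2 hα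
  -- Since mε² ≥ 11, this gives mδ² ≥ 275α, and ε < √α/10 gives δ ≤ α/2. The bias Lδ²/α is 25Lε².
  set δ : ℝ := 5 * ε * Real.sqrt α with hδdef
  -- The extra Lε² keeps τ positive when σ = 0; with the bias it makes up the constant 26.
  set τ : ℝ := ε * σ + L * ε ^ 2 with hτdef
  have hδ : 0 < δ := by positivity
  have hδα : δ ≤ α / 2 := by nlinarith
  have hδsq : δ ^ 2 = 25 * ε ^ 2 * α := by rw [hδdef, mul_pow, mul_pow, hsq]; ring
  have hτ : 0 < τ := by
    rcases hpos with h | h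
    · positivity
    · have : (0 : ℝ) < L := h
      positivity
  have hε2 : 0 < ε ^ 2 := by positivity
  have hε2' : ε ^ 2 < 1 := by nlinarith
  set m := blockSize ε with hmdef
  set n := numBlocks N ε with hndef
  have hm1 : 11 ≤ m * ε ^ 2 := (div_le_iff₀ hε2).1 (Nat.le_ceil _)
  have hm2 : m * ε ^ 2 ≤ 12 := by
    have h : (m : ℝ) < 11 / ε ^ 2 + 1 := Nat.ceil_lt_add_one (by positivity)
    have h' := mul_lt_mul_of_pos_right h hε2
    rw [add_mul, div_mul_cancel₀ _ hε2.ne'] at h'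
    linarith
  have hm0 : 0 < m := by
    rcases Nat.eq_zero_or_pos m with h | h
    · rw [h] at hm1; norm_num at hm1
    · exact h
  have hN' : 600 ≤ N * ε ^ 2 := (div_le_iff₀ hε2).1 hN
  have hnN : n * m ≤ N := Nat.div_mul_le_self N m
  have hn_low : (N : ℝ) * ε ^ 2 ≤ 12 * (n + 1) := by
    have h : N < m * (n + 1) := by
      rw [hndef, numBlocks, ← hmdef]
      exact Nat.lt_mul_div_succ N hm0
    have h' : (N : ℝ) ≤ m * (n + 1) := by exact_mod_cast h.le
    nlinarith [mul_le_mul_of_nonneg_right h' hε2.le, Nat.cast_nonneg (α := ℝ) n]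
  have hn20 : 20 ≤ n := by
    have : (20 : ℝ) ≤ n := by linarith
    exact_mod_cast this
  have hcard : ∀ j : Fin n, (block N m j).card = m := fun j =>
    card_block ((Nat.mul_le_mul_right m j.2).trans hnN)
  have hne : ∀ j : Fin n, (block N m j).Nonempty := fun j =>
    Finset.card_pos.1 (by rw [hcard j]; exact hm0)
  let A : Fin n → Set (Fin N → ℝ) := fun j => {x | ¬ IsGoodSample μ α δ τ x (block N m j)}
  have hA : ∀ j, MeasurableSet (A j) := fun j => (measurableSet_isGoodSample μ α δ τ _).compl
  -- This measurable event, that at least a quarter of the blocks are bad, encloses the deviation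
  -- event, so measurability of the estimator is not needed.
  refine ⟨{x | n ≤ 4 * (Finset.univ.filter fun j => x ∈ A j).card}, ?_, ?_, ?_⟩
  · have : Measurable fun x : Fin N → ℝ => (Finset.univ.filter fun j => x ∈ A j).card := by
      simp only [Finset.card_filter]
      exact Finset.measurable_sum _ fun j _ =>
        Measurable.ite (hA j) measurable_const measurable_const
    exact measurableSet_le measurable_const (measurable_const.mul this)
  · intro x hx
    by_contra hbad
    have hbad' : 4 * (Finset.univ.filter fun j => x ∈ A j).card < n := not_le.1 hbad
    set r := ε * σ + 26 * (L : ℝ) * ε ^ 2 with hrdef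
    have hr : τ + L * δ * (δ / α) = r := by
      have : (L : ℝ) * δ * (δ / α) = L * (δ ^ 2 / α) := by ring
      rw [this, hδsq, mul_div_cancel_right₀ _ hα.ne']
      ring
    have hT : ∀ j ∉ Finset.univ.filter fun j => x ∈ A j,
        blockEstimates α ε x j ∈ Ioo (ES α (cdf μ) - r) (ES α (cdf μ) + r) := by
      intro j hj
      have hgood : IsGoodSample μ α δ τ x (block N m j) := by
        by_contra h
        exact hj (Finset.mem_filter.2 ⟨Finset.mem_univ _, h⟩)
      have h := hgood.abs_plugIn_sub_lt (hne j) hα hα' hδ hδα hσ hL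
      rw [hr, abs_lt] at h
      exact ⟨by linarith! [h.1], by linarith! [h.2]⟩
    have hQ₁ := interpQuantile_mem_Ioo hT hbad' hn20 h₁ (h₁₂.trans h₂)
    have hQ₂ := interpQuantile_mem_Ioo hT hbad' hn20 (h₁.trans h₁₂) h₂
    have hlow : ES α (cdf μ) - r < estimator α ε β₁ β₂ x :=
      lt_min (hQ₁.1.trans_le (le_max_right _ _)) hQ₂.1
    have hup : estimator α ε β₁ β₂ x < ES α (cdf μ) + r := (min_le_right _ _).trans_lt hQ₂.2
    have : |estimator α ε β₁ β₂ x - ES α (cdf μ)| < r :=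
      abs_lt.2 ⟨by linarith, by linarith⟩
    exact absurd hx (not_le.2 this)
  · have hJ : Pairwise fun i j : Fin n => Disjoint (block N m i) (block N m j) :=
      fun i j hij => disjoint_block fun h => hij (Fin.ext h)
    refine (measure_quarter_le μ hJ hA (fun j x y hxy => ?_) fun j => ?_).trans ?_
    · exact not_congr (isGoodSample_congr μ α δ τ hxy)
    · refine measure_not_isGoodSample_le (hne j) hα hα' hσ hδ hδα hτ ?_ ?_
      · rw [hcard j, hδsq]
        nlinarith
      · rw [hcard j, ← hσdef]
        have h1 : (ε * σ) ^ 2 ≤ τ ^ 2 := by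
          refine pow_le_pow_left₀ (by positivity) ?_ 2
          rw [hτdef]
          linarith [show 0 ≤ (L : ℝ) * ε ^ 2 by positivity]
        nlinarith [mul_le_mul_of_nonneg_left h1 (Nat.cast_nonneg (α := ℝ) m),
          mul_le_mul_of_nonneg_right hm1 (sq_nonneg σ)]
    -- From n ≥ Nε²/12 - 1 and Nε² ≥ 600 one gets 0.03n ≥ 0.001Nε².
    · refine Real.exp_le_exp.2 ?_
      norm_num
      linarith

end MedianOfBlocks

end ExpectedShortfall

/-! ### Transfer from the product space to an arbitrary i.i.d. sample -/

theorem mainTheorem1 :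
    ∃ c₀ c₁ c₂ c₃ : ℝ, 0 < c₀ ∧ 0 < c₁ ∧ 0 < c₂ ∧ 0 < c₃ ∧
      ∀ {Ω : Type*} [MeasurableSpace Ω] (P : Measure Ω) [IsProbabilityMeasure P]
        (X : Ω → ℝ) (_ : AEMeasurable X P)
        (α : ℝ) (_ : 0 < α) (_ : α < 1 / 2)
        (β₁ β₂ : ℝ) (_ : 0.35 ≤ β₁) (_ : β₁ ≤ β₂) (_ : β₂ ≤ 0.65)
        (L : ℝ≥0)
        (_ : ExpectedShortfall.sigmaSq α (cdf (P.map X)) ≠ ⊤)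
        (_ : LipschitzOnWith L (fun u => ExpectedShortfall.VaR (cdf (P.map X)) u)
          (Icc (1 - 2 * α) (1 - α / 2)))
        (_ : 0 < ExpectedShortfall.sigma α (cdf (P.map X)) ∨ 0 < L)
        (ε : ℝ) (_ : 0 < ε) (_ : ε < c₀ * Real.sqrt α)
        (N : ℕ) (_ : c₁ / ε ^ 2 ≤ (N : ℝ))
        (Xs : Fin N → Ω → ℝ) (_ : iIndepFun Xs P) (_ : ∀ i, IdentDistrib (Xs i) X P P),
        P.real {ω | ε * ExpectedShortfall.sigma α (cdf (P.map X)) + c₂ * (L : ℝ) * ε ^ 2 ≤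
            |ExpectedShortfall.estimator α ε β₁ β₂ (fun i => Xs i ω) -
              ExpectedShortfall.ES α (cdf (P.map X))|} ≤
          Real.exp (-c₃ * (N : ℝ) * ε ^ 2) := by
  refine ⟨1 / 10, 600, 26, 0.001, by norm_num, by norm_num, by norm_num, by norm_num, ?_⟩
  intro Ω _ P _ X hX α hα hα' β₁ β₂ h₁ h₁₂ h₂ L hσ hL hpos ε hε hεα N hN Xs hind hid
  have : IsProbabilityMeasure (P.map X) := Measure.isProbabilityMeasure_map hX
  obtain ⟨A, hA, hsub, hle⟩ := ExpectedShortfall.exists_measurableSet_estimator_dev (N := N)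
    (P.map X) hα hα' h₁ h₁₂ h₂ hσ hL hpos hε hεα hN
  have hXs : ∀ i, AEMeasurable (Xs i) P := fun i => (hid i).aemeasurable_fst
  have hmap : P.map (fun ω i => Xs i ω) = Measure.pi fun _ => P.map X := by
    rw [(iIndepFun_iff_map_fun_eq_pi_map hXs).1 hind]
    simp_rw [(hid _).map_eq]
  rw [← hmap, map_measureReal_apply_of_aemeasurable (aemeasurable_pi_lambda _ hXs) hA] at hle
  exact (measureReal_mono (s₂ := (fun ω i => Xs i ω) ⁻¹' A) fun ω hω => hsub hω).trans hle
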